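/- Let $D\subset\mathbb C^2$ be a bounded convex domain with $\mathcal C^{1,1}$-smooth boundary (near each boundary point, $D$ is given as $\{\rho<0\}$ for a $\mathcal C^1$ function $\rho$ with Lipschitz, nowhere vanishing gradient). Suppose that there is a neighborhood $U$ of $0$ with $$D\cap U=\{z=(z_1,z_2)\in U:\ -\operatorname{Re} z_1+\psi(|z_2|)<0\},$$ where $\psi$ is a nonnegative convex function of class $\mathcal C^{1,1}$ on a neighborhood of $0$ in $\mathbb R$ such that $\psi(0)=0$ and $$\limsup_{x\to 0}\frac{\log\psi(|x|)}{\log|x|}=\infty$$ (with $\log 0=-\infty$, so that the quotient is $+\infty$ where $\psi(|x|)=0$, $0<|x|<1$). Let $\mathbb D$ be the unit disc, let $$l_D(z,w)=\inf\{\tanh^{-1}|\alpha|:\ \alpha\in\mathbb D,\ \exists\,\varphi:\mathbb D\to D\text{ holomorphic with }\varphi(0)=z,\ \varphi(\alpha)=w\}$$ be the Lempert function of $D$, and let the Kobayashi distance $k_D$ be the largest pseudodistance on $D$ not exceeding $l_D$. Then $(D,k_D)$ is not Gromov hyperbolic, i.e., with $(x,y)_z=k_D(x,z)+k_D(z,y)-k_D(x,y)$,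 $$\sup_{p,q,x,w\in D}\Big(\min\{(p,x)_w,(x,q)_w\}-(p,q)_w\Big)=\infty .$$ -/

import Mathlib

open Set Filter Topology
open scoped ENNReal NNReal

/-- `f` is of class `C^{1,1}` on the (open) set `U`: it is `C^1` there and its derivative is
Lipschitz on `U`. -/
def IsC11On {E : Type*} [NormedAddCommGroup E] [NormedSpace ℝ E] (f : E → ℝ) (U : Set E) : Prop :=
  ContDiffOn ℝ 1 f U ∧ ∃ K : ℝ≥0, LipschitzOnWith K (fderiv ℝ f) U

/-- The open set `D` has `C^{1,1}`-smooth boundary: near every boundary point it is the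
sublevel set `{ρ < 0}` of a `C^{1,1}` function whose derivative does not vanish. -/
def HasC11Boundary {E : Type*} [NormedAddCommGroup E] [NormedSpace ℝ E] (D : Set E) : Prop :=
  ∀ p ∈ frontier D, ∃ (U : Set E) (ρ : E → ℝ), IsOpen U ∧ p ∈ U ∧ IsC11On ρ U ∧
    (∀ z ∈ U, fderiv ℝ ρ z ≠ 0) ∧ D ∩ U = {z ∈ U | ρ z < 0}

section Kobayashi

variable {E : Type*} [NormedAddCommGroup E] [NormedSpace ℂ E]

/-- The Lempert function of `D`: the infimum of `tanh⁻¹ |α|` over all holomorphic maps `φ` of the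
unit disc into `D` with `φ 0 = z` and `φ α = w` (and `∞` if there are none). -/
noncomputable def lempertFun (D : Set E) (z w : E) : ℝ≥0∞ :=
  sInf {r | ∃ (φ : ℂ → E) (α : ℂ), DifferentiableOn ℂ φ (Metric.ball 0 1) ∧
    MapsTo φ (Metric.ball 0 1) D ∧ α ∈ Metric.ball (0 : ℂ) 1 ∧ φ 0 = z ∧ φ α = w ∧
    r = ENNReal.ofReal (Real.artanh ‖α‖)}

/-- `d` restricts to an (extended) pseudodistance on `D`. -/
structure IsPseudodistOn (D : Set E) (d : E → E → ℝ≥0∞) : Prop where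
  self : ∀ x ∈ D, d x x = 0
  symm : ∀ x ∈ D, ∀ y ∈ D, d x y = d y x
  triangle : ∀ x ∈ D, ∀ y ∈ D, ∀ z ∈ D, d x z ≤ d x y + d y z

/-- The Kobayashi pseudodistance of `D`, with values in `[0, ∞]`: the largest pseudodistance on `D`
that does not exceed the Lempert function. It is finite if `D` is open and connected. -/
noncomputable def kobayashiEDist (D : Set E) (z w : E) : ℝ≥0∞ :=
  sSup {r | ∃ d : E → E → ℝ≥0∞, IsPseudodistOn D d ∧
    (∀ x ∈ D, ∀ y ∈ D, d x y ≤ lempertFun D x y) ∧ r = d z w}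

/-- The Kobayashi distance of a domain `D`, as a real number. -/
noncomputable def kobayashiDist (D : Set E) (z w : E) : ℝ :=
  (kobayashiEDist D z w).toReal

end Kobayashi

/-- The Gromov product `(x, y)_z` (normalized without the factor `1/2`). -/
def gromovProd {X : Type*} (d : X → X → ℝ) (x y z : X) : ℝ :=
  d x z + d z y - d x y

/-- `(D, d)` is Gromov hyperbolic: `min {(p, x)_w, (x, q)_w} - (p, q)_w` is bounded above for
`p, q, x, w` in `D`. -/
def IsGromovHyperbolicOn {X : Type*} (D : Set X) (d : X → X → ℝ) : Prop :=
  ∃ C : ℝ, ∀ p ∈ D, ∀ q ∈ D, ∀ x ∈ D, ∀ w ∈ D,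
    min (gromovProd d p x w) (gromovProd d x q w) - gromovProd d p q w ≤ C

/-- `ψ` vanishes to infinite order at `0`: `limsup_{x → 0} log ψ(|x|) / log |x| = ∞`. The quotient
is taken in the extended reals, with `log 0 = -∞`, so that it is `+∞` where `ψ(|x|) = 0` and
`0 < |x| < 1`. -/
def VanishesToInfiniteOrder (ψ : ℝ → ℝ) : Prop :=
  limsup (fun x : ℝ => ENNReal.log (ENNReal.ofReal (ψ |x|)) / ((Real.log |x| : ℝ) : EReal))
    (𝓝[≠] 0) = ⊤

/-! ### Bounds for the Kobayashi distance: half-planes from below, discs from above -/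

section KobayashiBounds

variable {E : Type*} [NormedAddCommGroup E] [NormedSpace ℂ E]

/-! A product of a half-plane and a disc carries a max metric, so it contains arbitrarily large
squares whose diagonals are twice as long as their sides; hyperbolicity forbids this. `D` contains
sufficiently good truncated products `a / M ≤ Re z 0`, `‖z 0‖ ≤ a * M`, `‖z 1‖ < ρ`. In them a
single disc, the graph of a Möbius map over a Cayley transform, moves both coordinates by `L / 2` at
once, so a side costs at most `L / 2 + 1`. Projections to half-planes show that both diagonals have
length at least `L` up to a constant: one uses `Re z 0 > 0`, the other a real half-space containing
`D` whose boundary nearly touches the disc. Letting `L` grow gives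
`not_isGromovHyperbolicOn_of_almost_products`.

If `ψ` vanishes somewhere on `(0, ε)`, the boundary contains a flat disc, and the half-space comes
from separating a point just outside the largest centred disc of that face
(`exists_almost_product_of_flat`). Otherwise infinite order makes `x ψ'(x) / ψ(x)` unbounded. At
`(ψ(x), x)` the tangent half-space serves: moving to height `a`, comparable to `ψ(x)`, is negligible
against `x ψ'(x)` (`exists_almost_product_of_infinite_order`). -/

theorem kobayashiEDist_comm {D : Set E} {x y : E} (hx : x ∈ D) (hy : y ∈ D) :
    kobayashiEDist D x y = kobayashiEDist D y x := by
  unfold kobayashiEDist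
  congr 1
  ext r
  constructor <;> rintro ⟨d, hd, hl, rfl⟩
  · exact ⟨d, hd, hl, hd.symm x hx y hy⟩
  · exact ⟨d, hd, hl, hd.symm y hy x hx⟩

theorem IsPseudodistOn.le_kobayashiEDist {D : Set E} {d : E → E → ℝ≥0∞} (hd : IsPseudodistOn D d)
    (hl : ∀ x ∈ D, ∀ y ∈ D, d x y ≤ lempertFun D x y) (x y : E) : d x y ≤ kobayashiEDist D x y :=
  le_sSup ⟨d, hd, hl, rfl⟩

theorem kobayashiEDist_triangle {D : Set E} {x y z : E} (hx : x ∈ D) (hy : y ∈ D) (hz : z ∈ D) :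
    kobayashiEDist D x z ≤ kobayashiEDist D x y + kobayashiEDist D y z := by
  refine sSup_le ?_
  rintro r ⟨d, hd, hl, rfl⟩
  exact (hd.triangle x hx y hy z hz).trans
    (add_le_add (hd.le_kobayashiEDist hl x y) (hd.le_kobayashiEDist hl y z))

theorem kobayashiEDist_le_lempertFun {D : Set E} {x y : E} (hx : x ∈ D) (hy : y ∈ D) :
    kobayashiEDist D x y ≤ lempertFun D x y := by
  refine sSup_le ?_
  rintro r ⟨d, -, hl, rfl⟩
  exact hl x hx y hy

/-- Harnack's inequality for holomorphic functions on the disc with positive real part. -/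
theorem abs_re_sub_re_le_of_re_pos {f : ℂ → ℂ} (hf : DifferentiableOn ℂ f (Metric.ball 0 1))
    (hpos : ∀ z ∈ Metric.ball (0 : ℂ) 1, 0 < (f z).re) {α : ℂ} (hα : ‖α‖ < 1) :
    |(f α).re - (f 0).re| ≤ ‖α‖ * ((f α).re + (f 0).re) := by
  have h0 : 0 < (f 0).re := hpos 0 (by simp)
  have hα' : α ∈ Metric.ball (0 : ℂ) 1 := by simpa using hα
  have hne : ∀ z ∈ Metric.ball (0 : ℂ) 1, f z + (starRingEnd ℂ) (f 0) ≠ 0 := by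
    intro z hz h
    have := congrArg Complex.re h
    simp only [Complex.add_re, Complex.conj_re, Complex.zero_re] at this
    linarith [hpos z hz]
  -- Schwarz lemma, after mapping the half-plane to the disc with `f 0` sent to the centre.
  have key : ‖(f α - f 0) / (f α + (starRingEnd ℂ) (f 0))‖ ≤ ‖α‖ := by
    refine Complex.norm_le_norm_of_mapsTo_ball (R := 1)
      (f := fun z => (f z - f 0) / (f z + (starRingEnd ℂ) (f 0))) ?_ ?_ (by simp) hα
    · exact (hf.sub_const _).div (hf.add_const _) hne
    · intro z hz
      have hz' := hpos z hz
      rw [mem_closedBall_zero_iff, norm_div, div_le_one (norm_pos_iff.2 (hne z hz))]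
      rw [← sq_le_sq₀ (norm_nonneg _) (norm_nonneg _), Complex.sq_norm, Complex.sq_norm,
        Complex.normSq_apply, Complex.normSq_apply]
      simp only [Complex.sub_re, Complex.sub_im, Complex.add_re, Complex.add_im,
        Complex.conj_re, Complex.conj_im]
      nlinarith [mul_pos h0 hz']
  rw [norm_div, div_le_iff₀ (norm_pos_iff.2 (hne α hα')),
    ← sq_le_sq₀ (norm_nonneg _) (by positivity), mul_pow, Complex.sq_norm (f α - f 0),
    Complex.sq_norm (f α + _), Complex.normSq_apply, Complex.normSq_apply] at key
  simp only [Complex.sub_re, Complex.sub_im, Complex.add_re, Complex.add_im,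
    Complex.conj_re, Complex.conj_im] at key
  have hp := hpos α hα'
  refine abs_le_of_sq_le_sq ?_ (by positivity)
  -- Both sides of `key` contain the same squared difference of imaginary parts, with weights `1`
  -- and `‖α‖ ^ 2`, so it can be dropped.
  have h1 : 0 ≤ (1 - ‖α‖ ^ 2) * ((f α).im - (f 0).im) ^ 2 := by
    have : ‖α‖ ^ 2 ≤ 1 := pow_le_one₀ (norm_nonneg _) hα.le
    exact mul_nonneg (by linarith) (sq_nonneg _)
  nlinarith

theorem abs_log_re_sub_log_re_le_of_re_pos {f : ℂ → ℂ}
    (hf : DifferentiableOn ℂ f (Metric.ball 0 1))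
    (hpos : ∀ z ∈ Metric.ball (0 : ℂ) 1, 0 < (f z).re) {α : ℂ} (hα : ‖α‖ < 1) :
    |Real.log (f 0).re - Real.log (f α).re| / 2 ≤ Real.artanh ‖α‖ := by
  have h := abs_le.1 (abs_re_sub_re_le_of_re_pos hf hpos hα)
  have h0 : 0 < (f 0).re := hpos 0 (by simp)
  have h1 : 0 < (f α).re := hpos α (by simpa using hα)
  have hn := norm_nonneg α
  rw [Real.artanh_eq_half_log ⟨by linarith, hα.le⟩, Real.log_div (by positivity) (by linarith)]
  have e1 : Real.log (f 0).re + Real.log (1 - ‖α‖) ≤ Real.log (f α).re + Real.log (1 + ‖α‖) := by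
    rw [← Real.log_mul (by positivity) (by linarith), ← Real.log_mul (by positivity) (by positivity)]
    exact Real.log_le_log (mul_pos h0 (by linarith)) (by nlinarith)
  have e2 : Real.log (f α).re + Real.log (1 - ‖α‖) ≤ Real.log (f 0).re + Real.log (1 + ‖α‖) := by
    rw [← Real.log_mul (by positivity) (by linarith), ← Real.log_mul (by positivity) (by positivity)]
    exact Real.log_le_log (mul_pos h1 (by linarith)) (by nlinarith)
  have : |Real.log (f 0).re - Real.log (f α).re| ≤ Real.log (1 + ‖α‖) - Real.log (1 - ‖α‖) :=
    abs_le.2 ⟨by linarith, by linarith⟩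
  linarith

/-- A holomorphic map to the right half-plane bounds the Kobayashi distance from below. -/
theorem ofReal_abs_log_re_sub_le_kobayashiEDist {D : Set E} {h : E → ℂ} (hh : Differentiable ℂ h)
    (hpos : ∀ z ∈ D, 0 < (h z).re) (x y : E) :
    ENNReal.ofReal (|Real.log (h x).re - Real.log (h y).re| / 2) ≤ kobayashiEDist D x y := by
  refine IsPseudodistOn.le_kobayashiEDist (D := D)
    (d := fun x y => ENNReal.ofReal (|Real.log (h x).re - Real.log (h y).re| / 2)) ⟨?_, ?_, ?_⟩ ?_ x y
  · intro x _
    simp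
  · intro x _ y _
    simp only [abs_sub_comm]
  · intro x _ y _ z _
    rw [← ENNReal.ofReal_add (by positivity) (by positivity)]
    apply ENNReal.ofReal_le_ofReal
    linarith [abs_sub_le (Real.log (h x).re) (Real.log (h y).re) (Real.log (h z).re)]
  · intro x _ y _
    refine le_sInf ?_
    rintro r ⟨φ, α, hφ, hmaps, hα, rfl, rfl, rfl⟩
    exact ENNReal.ofReal_le_ofReal (abs_log_re_sub_log_re_le_of_re_pos (f := fun z => h (φ z))
      (hh.comp_differentiableOn hφ) (fun z hz => hpos _ (hmaps hz)) (by simpa using hα))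

/-- A holomorphic disc of radius `s` bounds the Kobayashi distance from above. -/
theorem kobayashiEDist_le_of_disc {D : Set E} {Φ : ℂ → E} {s T : ℝ} (hT : 0 < T) (hTs : T < s)
    (hΦ : DifferentiableOn ℂ Φ (Metric.ball 0 s)) (hmaps : MapsTo Φ (Metric.ball 0 s) D) :
    kobayashiEDist D (Φ 0) (Φ T) ≤ ENNReal.ofReal (Real.artanh (T / s)) := by
  have hs : 0 < s := hT.trans hTs
  have hball : MapsTo (fun ζ : ℂ => (s : ℂ) * ζ) (Metric.ball 0 1) (Metric.ball 0 s) := by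
    intro ζ hζ
    simp only [mem_ball_zero_iff, norm_mul, Complex.norm_real, Real.norm_eq_abs, abs_of_pos hs] at *
    nlinarith
  have hn : ‖((T / s : ℝ) : ℂ)‖ = T / s := by
    rw [Complex.norm_real, Real.norm_eq_abs, abs_of_pos (by positivity)]
  refine (kobayashiEDist_le_lempertFun (hmaps (by simpa using hs)) (hmaps ?_)).trans
    (sInf_le ⟨fun ζ => Φ (s * ζ), (T / s : ℝ), ?_, ?_, ?_, by simp, ?_, by rw [hn]⟩)
  · simpa [abs_of_pos hT] using hTs
  · exact hΦ.comp (by fun_prop) hball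
  · exact fun ζ hζ => hmaps (hball hζ)
  · rw [mem_ball_zero_iff, hn, div_lt_one hs]
    exact hTs
  · have : (s : ℂ) ≠ 0 := by exact_mod_cast hs.ne'
    push_cast
    rw [mul_div_cancel₀ _ this]

end KobayashiBounds

/-! ### Holomorphic discs in a truncated product -/

/-- The Cayley transform sends `‖w‖ < s` to the disc with diameter from `(1 - s) / (1 + s)` to `(1 +
s) / (1 - s)`; together with `norm_cayley_le` this keeps the first coordinate in the truncated
half-plane. -/
theorem inv_le_re_cayley {w : ℂ} {s : ℝ} (hw : ‖w‖ < s) (hs : s < 1) :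
    (1 - s) / (1 + s) ≤ ((1 + w) / (1 - w)).re := by
  have h0 := norm_nonneg w
  have hre := abs_le.1 (Complex.abs_re_le_norm w)
  have hsq : w.re * w.re + w.im * w.im = ‖w‖ ^ 2 := by
    rw [Complex.sq_norm, Complex.normSq_apply]
  have hpos : 0 < Complex.normSq (1 - w) := by
    rw [Complex.normSq_pos]
    intro h
    have := congrArg Complex.re h
    simp at this
    linarith
  rw [Complex.div_re, ← add_div, div_le_div_iff₀ (by linarith) hpos]
  simp only [Complex.normSq_apply, Complex.add_re, Complex.sub_re, Complex.one_re, Complex.add_im,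
    Complex.sub_im, Complex.one_im]
  have h1 : (1 - w.re) * (1 - w.re) + (0 - w.im) * (0 - w.im) ≤ (1 + s) ^ 2 := by nlinarith
  have h2 : (1 - s) * (1 + s) ≤ 1 - ‖w‖ ^ 2 := by nlinarith
  calc (1 - s) * ((1 - w.re) * (1 - w.re) + (0 - w.im) * (0 - w.im))
      ≤ (1 - s) * (1 + s) ^ 2 := mul_le_mul_of_nonneg_left h1 (by linarith)
    _ = ((1 - s) * (1 + s)) * (1 + s) := by ring
    _ ≤ (1 - ‖w‖ ^ 2) * (1 + s) := mul_le_mul_of_nonneg_right h2 (by linarith)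
    _ = _ := by rw [← hsq]; ring

theorem norm_cayley_le {w : ℂ} {s : ℝ} (hw : ‖w‖ < s) (hs : s < 1) :
    ‖(1 + w) / (1 - w)‖ ≤ (1 + s) / (1 - s) := by
  have h1 : ‖1 + w‖ ≤ 1 + s := (norm_add_le _ _).trans (by rw [norm_one]; linarith)
  have h2 : 1 - s ≤ ‖1 - w‖ := by
    have := norm_sub_norm_le (1 : ℂ) w
    rw [norm_one] at this
    linarith
  rw [norm_div]
  exact div_le_div₀ (by linarith [norm_nonneg w]) h1 (by linarith) h2

theorem one_add_mul_ne_zero {ζ : ℂ} {κ : ℝ} (hζ : ‖ζ‖ < 1) (h0 : |κ| ≤ 1) :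
    1 + (κ : ℂ) * ζ ≠ 0 := by
  intro h
  have h1 : (κ : ℂ) * ζ = -1 := by linear_combination h
  have h2 := congrArg norm h1
  rw [norm_mul, Complex.norm_real, Real.norm_eq_abs, norm_neg, norm_one] at h2
  nlinarith [norm_nonneg ζ, abs_nonneg κ]

theorem norm_mobius_lt_one {ζ : ℂ} {κ : ℝ} (hζ : ‖ζ‖ < 1) (h0 : 0 ≤ κ) (h1 : κ < 1) :
    ‖(ζ + κ) / (1 + κ * ζ)‖ < 1 := by
  have hne := one_add_mul_ne_zero hζ (κ := κ) (by rw [abs_of_nonneg h0]; exact h1.le)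
  rw [norm_div, div_lt_one (norm_pos_iff.2 hne), ← sq_lt_sq₀ (norm_nonneg _) (norm_nonneg _),
    Complex.sq_norm, Complex.sq_norm, Complex.normSq_apply, Complex.normSq_apply]
  have hsq : ζ.re * ζ.re + ζ.im * ζ.im < 1 := by
    rw [← Complex.normSq_apply, ← Complex.sq_norm]
    nlinarith [norm_nonneg ζ]
  simp only [Complex.add_re, Complex.add_im, Complex.ofReal_re, Complex.ofReal_im, Complex.one_re,
    Complex.one_im, Complex.mul_re, Complex.mul_im]
  -- `‖1 + κ ζ‖ ^ 2 - ‖ζ + κ‖ ^ 2 = (1 - ‖ζ‖ ^ 2) (1 - κ ^ 2)`.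
  nlinarith [mul_pos (sub_pos.2 hsq) (show 0 < 1 - κ ^ 2 by nlinarith)]

/-- The graph of a Möbius map of the disc over a Cayley transform, contained in the product of a
truncated half-plane and a disc. -/
theorem kobayashiEDist_le_of_product_subset {D : Set (EuclideanSpace ℂ (Fin 2))}
    {a M ρ c σ κ s T : ℝ} {R : ℂ} (hρ : 0 < ρ) (hR : ‖R‖ = ρ)
    (hsub : ∀ z : EuclideanSpace ℂ (Fin 2),
      a / M ≤ (z 0).re → ‖z 0‖ ≤ a * M → ‖z 1‖ < ρ → z ∈ D)
    (hc : 0 < c) (hσ : |σ| = 1) (hκ0 : 0 ≤ κ) (hκ1 : κ < 1) (hT : 0 < T) (hTs : T < s) (hs : s < 1)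
    (hlow : a / M ≤ c * ((1 - s) / (1 + s))) (hup : c * ((1 + s) / (1 - s)) ≤ a * M) :
    kobayashiEDist D !₂[(c : ℂ), R * κ]
      !₂[((c * ((1 + σ * T) / (1 - σ * T)) : ℝ) : ℂ), R * ((T + κ) / (1 + κ * T) : ℝ)]
      ≤ ENNReal.ofReal (Real.artanh (T / s)) := by
  have hσn : ∀ ζ : ℂ, ‖(σ : ℂ) * ζ‖ = ‖ζ‖ := fun ζ => by
    rw [norm_mul, Complex.norm_real, Real.norm_eq_abs, hσ, one_mul]
  have hne1 : ∀ ζ ∈ Metric.ball (0 : ℂ) s, 1 - (σ : ℂ) * ζ ≠ 0 := fun ζ hζ => by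
    have := one_add_mul_ne_zero (ζ := ζ) (κ := -σ) ((mem_ball_zero_iff.1 hζ).trans hs)
      (by rw [abs_neg, hσ])
    push_cast at this
    rwa [neg_mul, ← sub_eq_add_neg] at this
  have hne2 : ∀ ζ ∈ Metric.ball (0 : ℂ) s, 1 + (κ : ℂ) * ζ ≠ 0 := fun ζ hζ =>
    one_add_mul_ne_zero ((mem_ball_zero_iff.1 hζ).trans hs) (by rw [abs_of_nonneg hκ0]; exact hκ1.le)
  have key := kobayashiEDist_le_of_disc (D := D) (s := s) hT hTs
    (Φ := fun ζ => !₂[(c : ℂ) * ((1 + σ * ζ) / (1 - σ * ζ)), R * ((ζ + κ) / (1 + κ * ζ))]) ?_ ?_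
  · simpa using key
  · rw [differentiableOn_euclidean]
    intro i
    fin_cases i
    · exact (DifferentiableOn.div (by fun_prop) (by fun_prop) hne1).const_mul _
    · exact (DifferentiableOn.div (by fun_prop) (by fun_prop) hne2).const_mul _
  · intro ζ hζ
    have hζs := mem_ball_zero_iff.1 hζ
    refine hsub _ ?_ ?_ ?_
    · simp only [Matrix.cons_val_zero]
      rw [Complex.re_ofReal_mul]
      exact hlow.trans (mul_le_mul_of_nonneg_left
        (inv_le_re_cayley (by rwa [hσn]) hs) hc.le)
    · simp only [Matrix.cons_val_zero]
      rw [norm_mul, Complex.norm_real, Real.norm_eq_abs, abs_of_pos hc]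
      exact (mul_le_mul_of_nonneg_left (norm_cayley_le (by rwa [hσn]) hs) hc.le).trans hup
    · simp only [Matrix.cons_val_one, Matrix.cons_val_fin_one]
      rw [norm_mul, hR]
      exact mul_lt_of_lt_one_right hρ (norm_mobius_lt_one (hζs.trans hs) hκ0 hκ1)

/-- Truncation only admits discs of radius `s < 1`, which see `T` at `T / s`. The loss can be kept
at `1` for every `T`, which is harmless for long sides. -/
theorem exists_artanh_div_eq_add_one {T : ℝ} (hT0 : 0 < T) (hT1 : T < 1) :
    ∃ s, T < s ∧ s < 1 ∧ Real.artanh (T / s) = Real.artanh T + 1 := by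
  set α := Real.tanh (Real.artanh T + 1) with hα
  have hα1 : α < 1 := Real.tanh_lt_one _
  have hTα : T < α := by
    by_contra! h
    have := Real.artanh_le_artanh (Real.neg_one_lt_tanh _) hT1 h
    rw [Real.artanh_tanh] at this
    linarith
  have hα0 : 0 < α := hT0.trans hTα
  refine ⟨T / α, ?_, (div_lt_one hα0).2 hTα, ?_⟩
  · rw [lt_div_iff₀ hα0]
    nlinarith
  · rw [div_div_cancel₀ hT0.ne', hα, Real.artanh_tanh]

/-! ### The four-point condition on almost-products -/

/-- A quantitative failure of the four point condition: two long crossing segments whose endpoints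
are cyclically close. -/
theorem le_of_isGromovHyperbolicOn {X : Type*} {D : Set X} {d : X → X → ℝ} {C A B₁ B₂ : ℝ}
    (hd : ∀ x ∈ D, ∀ y ∈ D, d x y = d y x)
    (hC : ∀ p ∈ D, ∀ q ∈ D, ∀ x ∈ D, ∀ w ∈ D,
      min (gromovProd d p x w) (gromovProd d x q w) - gromovProd d p q w ≤ C)
    {p q x w : X} (hp : p ∈ D) (hq : q ∈ D) (hx : x ∈ D) (hw : w ∈ D)
    (hxp : d x p ≤ A) (hxq : d x q ≤ A) (hpw : d p w ≤ A) (hqw : d q w ≤ A)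
    (hpq : B₁ ≤ d p q) (hxw : B₂ ≤ d x w) : B₁ + B₂ - 2 * A ≤ C := by
  have h := hC p hp q hq x hx w hw
  have e1 := hd p hp x hx
  have e2 := hd w hw x hx
  have e3 := hd w hw q hq
  unfold gromovProd at h
  rcases min_cases (d p w + d w x - d p x) (d x w + d w q - d x q) with ⟨h1, -⟩ | ⟨h1, -⟩ <;>
    rw [h1] at h <;> linarith

/-- If `D` contains arbitrarily long almost-products of a truncated half-plane and a disc, whose
two directions are controlled from outside by half-spaces, then `D` is not Gromov hyperbolic. -/
theorem not_isGromovHyperbolicOn_of_almost_products {D : Set (EuclideanSpace ℂ (Fin 2))}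
    (hre : ∀ z ∈ D, 0 < (z 0).re)
    (h : ∀ T M : ℝ, 0 < T → T < 1 → 1 < M → ∃ (a ρ k : ℝ) (ω c ν : ℂ), 0 < a ∧ 0 < ρ ∧ ‖ω‖ = 1 ∧
      (∀ z : EuclideanSpace ℂ (Fin 2), a / M ≤ (z 0).re → ‖z 0‖ ≤ a * M → ‖z 1‖ < ρ → z ∈ D) ∧
      (∀ z ∈ D, 0 < k + (c * z 0).re - (ν * z 1).re) ∧
      ((1 + T) / (1 - T)) ^ 2 * (k + a * c.re - ρ * (2 * T / (1 + T ^ 2)) * (ν * ω).re) ≤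
        10 * (k + a * c.re)) :
    ¬ IsGromovHyperbolicOn D (kobayashiDist D) := by
  rintro ⟨C, hC⟩
  -- Diagonals minus sides will be at least `L + (L - log 10 / 2) - 2 (L / 2 + 1) = |C| + 1 > C`.
  set L := |C| + 3 + Real.log 10 / 2 with hL
  have hL0 : 0 < L := by
    have := Real.log_nonneg (show (1 : ℝ) ≤ 10 by norm_num)
    positivity
  obtain ⟨T, hT0, hT1, hTL⟩ : ∃ T : ℝ, 0 < T ∧ T < 1 ∧ (1 + T) / (1 - T) = Real.exp L := by
    have h1 : 1 < Real.exp L := Real.one_lt_exp_iff.2 hL0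
    refine ⟨(Real.exp L - 1) / (Real.exp L + 1), div_pos (by linarith) (by linarith),
      (div_lt_one (by linarith)).2 (by linarith), ?_⟩
    have : Real.exp L + 1 ≠ 0 := by positivity
    rw [div_eq_iff]
    · field_simp
      ring
    · rw [one_sub_div this]
      exact div_ne_zero (by norm_num) this
  set q := Real.exp L with hq
  have hq1 : 1 < q := Real.one_lt_exp_iff.2 hL0
  have hq0 : 0 < q := by linarith
  have hTq : (1 - T) / (1 + T) = q⁻¹ := by rw [← hTL, inv_div]
  have hartanh : Real.artanh T = L / 2 := by
    rw [Real.artanh_eq_half_log ⟨by linarith, hT1.le⟩, hTL, hq, Real.log_exp]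
    ring
  obtain ⟨s, hTs, hs1, hs⟩ := exists_artanh_div_eq_add_one hT0 hT1
  set N := (1 + s) / (1 - s) with hN
  have hN1 : 1 < N := (one_lt_div (by linarith)).2 (by linarith)
  have hN0 : 0 < N := by linarith
  have hNinv : (1 - s) / (1 + s) = N⁻¹ := by rw [hN, inv_div]
  -- The factor `q` covers the heights `a / q` to `a * q` of the corners, and `N` the spread of the
  -- Cayley image of the disc of radius `s`.
  have hM : 1 < q * N := one_lt_mul_of_lt_of_le hq1 hN1.le
  obtain ⟨a, ρ, k, ω, c, ν, ha, hρ, hω, hsub, hpos, hratio⟩ := h T (q * N) hT0 hT1 hM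
  set R : ℂ := ρ * ω with hRdef
  have hR : ‖R‖ = ρ := by
    rw [hRdef, norm_mul, hω, mul_one, Complex.norm_real, Real.norm_eq_abs, abs_of_pos hρ]
  -- `artanh τ = 2 artanh T = L`: two sides in succession reach `τ` in the disc.
  set τ := 2 * T / (1 + T ^ 2) with hτ
  have hτ0 : 0 ≤ τ := by positivity
  have hτ1 : τ < 1 := by
    rw [hτ, div_lt_one (by positivity)]
    nlinarith [sq_nonneg (1 - T), sub_pos.2 hT1]
  have hmem : ∀ b θ : ℝ, a / q ≤ b → b ≤ a * q → 0 ≤ θ → θ < 1 → !₂[(b : ℂ), R * θ] ∈ D := by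
    intro b θ hb1 hb2 hθ0 hθ1
    have hb0 : 0 < b := lt_of_lt_of_le (by positivity) hb1
    refine hsub _ ?_ ?_ ?_
    · simp only [Matrix.cons_val_zero, Complex.ofReal_re]
      refine le_trans ?_ hb1
      exact div_le_div_of_nonneg_left ha.le hq0 (le_mul_of_one_le_right hq0.le hN1.le)
    · simp only [Matrix.cons_val_zero, Complex.norm_real, Real.norm_eq_abs,
        abs_of_pos hb0]
      refine hb2.trans (mul_le_mul_of_nonneg_left (le_mul_of_one_le_right hq0.le hN1.le) ha.le)
    · simp only [Matrix.cons_val_one, Matrix.cons_val_fin_one, norm_mul, hR,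
        Complex.norm_real, Real.norm_eq_abs, abs_of_nonneg hθ0]
      exact mul_lt_of_lt_one_right hρ hθ1
  have haq : a / q ≤ a := div_le_self ha.le hq1.le
  have haq' : a ≤ a * q := le_mul_of_one_le_right ha.le hq1.le
  have mx := hmem a 0 haq haq' le_rfl one_pos
  have mp := hmem (a / q) T le_rfl (haq.trans haq') hT0.le hT1
  have mq := hmem (a * q) T (haq.trans haq') le_rfl hT0.le hT1
  have mw := hmem a τ haq haq' hτ0 hτ1
  have hdisc : ∀ b σ κ b' κ' : ℝ, a / q ≤ b → b ≤ a * q → |σ| = 1 → 0 ≤ κ → κ < 1 →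
      b * ((1 + σ * T) / (1 - σ * T)) = b' → (T + κ) / (1 + κ * T) = κ' →
      kobayashiEDist D !₂[(b : ℂ), R * κ] !₂[(b' : ℂ), R * κ'] ≤ ENNReal.ofReal (L / 2 + 1) := by
    intro b σ κ b' κ' hb1 hb2 hσ hκ0 hκ1 hb' hκ'
    have := kobayashiEDist_le_of_product_subset hρ hR hsub (c := b) (σ := σ) (κ := κ) (s := s)
      (T := T) (lt_of_lt_of_le (by positivity) hb1) hσ hκ0 hκ1 hT0 hTs hs1 ?_ ?_
    · rwa [hb', hκ', hs, hartanh] at this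
    · rw [hNinv, ← div_eq_mul_inv, ← div_div]
      exact div_le_div_of_nonneg_right hb1 hN0.le
    · rw [← mul_assoc]
      exact mul_le_mul_of_nonneg_right hb2 hN0.le
  have hpl : (1 + 1 * T) / (1 - 1 * T) = q := by rw [one_mul, hTL]
  have hmi : (1 + -1 * T) / (1 - -1 * T) = q⁻¹ := by rw [← hTq]; ring
  have hTT : (T + T) / (1 + T * T) = τ := by rw [hτ]; ring
  have bxp := hdisc a (-1) 0 (a / q) T haq haq' (by simp) le_rfl one_pos
    (by rw [hmi, div_eq_mul_inv]) (by simp)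
  have bxq := hdisc a 1 0 (a * q) T haq haq' (by simp) le_rfl one_pos (by rw [hpl]) (by simp)
  have bpw := hdisc (a / q) 1 T a τ le_rfl (haq.trans haq') (by simp) hT0.le hT1
    (by rw [hpl, div_mul_cancel₀ _ hq0.ne']) hTT
  have bqw := hdisc (a * q) (-1) T a τ (haq.trans haq') le_rfl (by simp) hT0.le hT1
    (by rw [hmi, mul_inv_cancel_right₀ hq0.ne']) hTT
  set x : EuclideanSpace ℂ (Fin 2) := !₂[(a : ℂ), R * (0 : ℝ)] with hx
  set P : EuclideanSpace ℂ (Fin 2) := !₂[((a / q : ℝ) : ℂ), R * T] with hP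
  set Q : EuclideanSpace ℂ (Fin 2) := !₂[((a * q : ℝ) : ℂ), R * T] with hQ
  set w : EuclideanSpace ℂ (Fin 2) := !₂[(a : ℂ), R * τ] with hw
  have hA : 0 ≤ L / 2 + 1 := by positivity
  have toR : ∀ {y z : EuclideanSpace ℂ (Fin 2)},
      kobayashiEDist D y z ≤ ENNReal.ofReal (L / 2 + 1) → kobayashiDist D y z ≤ L / 2 + 1 :=
    fun hyz => ENNReal.toReal_le_of_le_ofReal hA hyz
  have fin1 : kobayashiEDist D P Q ≠ ∞ := by
    refine ne_top_of_le_ne_top ?_ (kobayashiEDist_triangle mp mx mq)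
    rw [kobayashiEDist_comm mp mx]
    exact ENNReal.add_ne_top.2 ⟨ne_top_of_le_ne_top ENNReal.ofReal_ne_top bxp,
      ne_top_of_le_ne_top ENNReal.ofReal_ne_top bxq⟩
  have fin2 : kobayashiEDist D x w ≠ ∞ := by
    refine ne_top_of_le_ne_top ?_ (kobayashiEDist_triangle mx mp mw)
    exact ENNReal.add_ne_top.2 ⟨ne_top_of_le_ne_top ENNReal.ofReal_ne_top bxp,
      ne_top_of_le_ne_top ENNReal.ofReal_ne_top bpw⟩
  have lowPQ : L ≤ kobayashiDist D P Q := by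
    have h1 := ofReal_abs_log_re_sub_le_kobayashiEDist (D := D)
      (h := fun z : EuclideanSpace ℂ (Fin 2) => z 0) (by fun_prop) hre P Q
    have h2 := (ENNReal.ofReal_le_iff_le_toReal fin1).1 h1
    refine le_trans ?_ h2
    simp only [hP, hQ, PiLp.toLp_apply, Matrix.cons_val_zero, Complex.ofReal_re]
    rw [Real.log_div ha.ne' hq0.ne', Real.log_mul ha.ne' hq0.ne', hq, Real.log_exp]
    rw [show Real.log a - L - (Real.log a + L) = -(2 * L) by ring, abs_neg,
      abs_of_pos (by positivity)]
    linarith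
  have lowxw : L - Real.log 10 / 2 ≤ kobayashiDist D x w := by
    have hfun : ∀ z : EuclideanSpace ℂ (Fin 2),
        ((k : ℂ) + c * z 0 - ν * z 1).re = k + (c * z 0).re - (ν * z 1).re := fun z => by simp
    have h1 := ofReal_abs_log_re_sub_le_kobayashiEDist (D := D)
      (h := fun z : EuclideanSpace ℂ (Fin 2) => (k : ℂ) + c * z 0 - ν * z 1) (by fun_prop)
      (fun z hz => by rw [hfun]; exact hpos z hz) x w
    have h2 := (ENNReal.ofReal_le_iff_le_toReal fin2).1 h1
    refine le_trans ?_ h2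
    have ex : k + (c * x 0).re - (ν * x 1).re = k + a * c.re := by
      simp [hx, mul_comm]
    have ew : k + (c * w 0).re - (ν * w 1).re = k + a * c.re - ρ * τ * (ν * ω).re := by
      have : ν * w 1 = ((ρ * τ : ℝ) : ℂ) * (ν * ω) := by
        simp only [hw, hRdef, PiLp.toLp_apply, Matrix.cons_val_one, Matrix.cons_val_fin_one]
        push_cast
        ring
      rw [this, Complex.re_ofReal_mul]
      simp [hw, mul_comm]
    have px := hpos x mx
    have pw := hpos w mw
    simp only [hfun]
    rw [ex] at px ⊢
    rw [ew] at pw ⊢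
    -- `hratio` bounds below by `q ^ 2 / 10` the ratio of the affine function's values at `x` and
    -- `w`; half its logarithm is `L - log 10 / 2`.
    rw [hTL] at hratio
    have h3 := Real.log_le_log (by positivity) hratio
    rw [Real.log_mul (by positivity) pw.ne', Real.log_mul (by norm_num) px.ne', Real.log_pow, hq,
      Real.log_exp] at h3
    push_cast at h3
    have h4 := le_abs_self (Real.log (k + a * c.re) -
      Real.log (k + a * c.re - ρ * τ * (ν * ω).re))
    linarith
  have final := le_of_isGromovHyperbolicOn (d := kobayashiDist D)
    (fun y hy z hz => by unfold kobayashiDist; rw [kobayashiEDist_comm hy hz])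
    hC mp mq mx mw (toR bxp) (toR bxq) (toR bpw) (toR bqw) lowPQ lowxw
  have := le_abs_self C
  linarith

/-! ### Convexity, closure points and an elementary estimate -/

/-- A strict affine inequality that holds on a convex open set near one of its closure points holds
on the whole set. -/
theorem Convex.lt_of_eventually_lt_near {E : Type*} [NormedAddCommGroup E] [NormedSpace ℝ E]
    {D : Set E} (hconv : Convex ℝ D) (hopen : IsOpen D) {P : E} (hP : P ∈ closure D) {l : E → ℝ}
    (hl : ∀ (z : E) (s : ℝ), l (s • z + (1 - s) • P) = s * l z + (1 - s) * l P)
    (hloc : ∀ᶠ z in 𝓝 P, z ∈ D → l P < l z) {z : E} (hz : z ∈ D) : l P < l z := by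
  have hcont : Tendsto (fun s : ℝ => s • z + (1 - s) • P) (𝓝[>] 0) (𝓝 P) := by
    have : Continuous (fun s : ℝ => s • z + (1 - s) • P) := by fun_prop
    have h := (this.tendsto 0).mono_left (nhdsWithin_le_nhds (s := Ioi 0))
    simpa using h
  obtain ⟨s, hs, hs0, hs1⟩ := ((hcont.eventually hloc).and
    ((eventually_mem_nhdsWithin (s := Ioi (0 : ℝ)) (a := 0)).and
      (mem_nhdsWithin_of_mem_nhds (Iio_mem_nhds one_pos)))).exists
  have hs0 : 0 < s := hs0
  have hs1 : s < 1 := hs1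
  have hmem : s • z + (1 - s) • P ∈ D := interior_subset
    (hconv.combo_interior_closure_mem_interior (by rwa [hopen.interior_eq]) hP hs0
      (by linarith) (by ring))
  have h := hs hmem
  rw [hl] at h
  nlinarith

theorem norm_le_norm_add_norm_apply (z : EuclideanSpace ℂ (Fin 2)) : ‖z‖ ≤ ‖z 0‖ + ‖z 1‖ := by
  rw [EuclideanSpace.norm_eq, Fin.sum_univ_two]
  refine Real.sqrt_le_iff.2 ⟨by positivity, ?_⟩
  nlinarith [norm_nonneg (z 0), norm_nonneg (z 1)]

theorem mem_closure_of_forall_pos {D : Set (EuclideanSpace ℂ (Fin 2))} {b δ : ℝ} {v : ℂ}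
    (hδ : 0 < δ) (h : ∀ s : ℝ, 0 < s → s < δ → !₂[((b + s : ℝ) : ℂ), v] ∈ D) :
    !₂[(b : ℂ), v] ∈ closure D := by
  have hcont : Continuous (fun s : ℝ => (!₂[((b + s : ℝ) : ℂ), v] : EuclideanSpace ℂ (Fin 2))) := by
    refine (PiLp.continuous_toLp 2 _).comp (continuous_pi fun i => ?_)
    fin_cases i
    · simp only [Fin.zero_eta, Matrix.cons_val_zero]
      fun_prop
    · simp only [Fin.mk_one, Matrix.cons_val_one, Matrix.cons_val_fin_one]
      fun_prop
  have ht := (hcont.tendsto 0).mono_left (nhdsWithin_le_nhds (s := Ioi 0))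
  rw [add_zero] at ht
  refine mem_closure_of_tendsto ht ?_
  filter_upwards [Ioo_mem_nhdsGT hδ] with s hs using h s hs.1 hs.2

/-- Since `1 - 2T / (1 + T²) = (1 - T)² / (1 + T²)`, the pole at `T = 1` cancels. -/
theorem sq_mul_one_sub_double_le_two {T : ℝ} (hT0 : 0 < T) (hT1 : T < 1) :
    ((1 + T) / (1 - T)) ^ 2 * (1 - 2 * T / (1 + T ^ 2)) ≤ 2 := by
  have h1 : (0 : ℝ) < 1 - T := by linarith
  have : ((1 + T) / (1 - T)) ^ 2 * (1 - 2 * T / (1 + T ^ 2)) = (1 + T) ^ 2 / (1 + T ^ 2) := by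
    have h2 : (1 - T) ≠ 0 := h1.ne'
    have h3 : 1 + T ^ 2 ≠ 0 := by positivity
    field_simp
    ring
  rw [this, div_le_iff₀ (by positivity)]
  nlinarith [sq_nonneg (1 - T)]

/-! ### Almost-products at a flat boundary point -/

/-- If the boundary of `D` is flat near `0`, the maximal disc in the face through `0` yields
almost-products. -/
theorem exists_almost_product_of_flat {D : Set (EuclideanSpace ℂ (Fin 2))} (hopen : IsOpen D)
    (hconv : Convex ℝ D) (hbdd : Bornology.IsBounded D) {r : ℝ} (hr : 0 < r)
    (hflat : ∀ z : EuclideanSpace ℂ (Fin 2), ‖z‖ < r → 0 < (z 0).re → z ∈ D)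
    {T M : ℝ} (hT0 : 0 < T) (hT1 : T < 1) (hM : 1 < M) :
    ∃ (a ρ k : ℝ) (ω c ν : ℂ), 0 < a ∧ 0 < ρ ∧ ‖ω‖ = 1 ∧
      (∀ z : EuclideanSpace ℂ (Fin 2), a / M ≤ (z 0).re → ‖z 0‖ ≤ a * M → ‖z 1‖ < ρ → z ∈ D) ∧
      (∀ z ∈ D, 0 < k + (c * z 0).re - (ν * z 1).re) ∧
      ((1 + T) / (1 - T)) ^ 2 * (k + a * c.re - ρ * (2 * T / (1 + T ^ 2)) * (ν * ω).re) ≤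
        10 * (k + a * c.re) := by
  set F : Set ℂ := {v | !₂[(0 : ℂ), v] ∈ closure D} with hF
  have hball : ∀ v : ℂ, ‖v‖ < r → v ∈ F := by
    intro v hv
    have := mem_closure_of_forall_pos (D := D) (b := 0) (v := v) (sub_pos.2 hv) ?_
    · simpa [hF] using this
    intro s hs0 hs
    refine hflat _ ((norm_le_norm_add_norm_apply _).trans_lt ?_) (by simpa using hs0)
    simp only [zero_add, Matrix.cons_val_zero, Matrix.cons_val_one, Matrix.cons_val_fin_one,
      Complex.norm_real, Real.norm_eq_abs, abs_of_pos hs0]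
    linarith
  have hFc : Fᶜ.Nonempty := by
    obtain ⟨K, hK⟩ := hbdd.closure.exists_norm_le
    refine ⟨((|K| + 1 : ℝ) : ℂ), fun hv => ?_⟩
    have h1 := hK _ hv
    have h2 := PiLp.norm_apply_le (p := 2) (!₂[(0 : ℂ), ((|K| + 1 : ℝ) : ℂ)]) 1
    simp only [Matrix.cons_val_one, Matrix.cons_val_fin_one, Complex.norm_real,
      Real.norm_eq_abs] at h2
    rw [abs_of_pos (by positivity)] at h2
    linarith [le_abs_self K]
  set b := Metric.infDist (0 : ℂ) Fᶜ with hb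
  have hrb : r ≤ b := (Metric.le_infDist hFc).2 fun {v} hv => by
    by_contra! h
    exact hv (hball v (by simpa using h))
  have hb0 : 0 < b := hr.trans_le hrb
  have hbF : ∀ v : ℂ, ‖v‖ < b → v ∈ F := by
    intro v hv
    by_contra h
    have := Metric.infDist_le_dist_of_mem (x := (0 : ℂ)) (s := Fᶜ) h
    rw [dist_zero_left] at this
    linarith
  set q := (1 + T) / (1 - T) with hq
  have hq1 : 1 < q := (one_lt_div (by linarith)).2 (by linarith)
  -- Errors of relative size `η` must survive multiplication by `q ^ 2`.
  set η := 1 / (4 * q ^ 2) with hη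
  have hη0 : 0 < η := by positivity
  have hqη : q ^ 2 * η = 1 / 4 := by
    rw [hη]
    field_simp
  have hη4 : η ≤ 1 / 4 := by nlinarith
  obtain ⟨v, hvF, hv⟩ := (Metric.infDist_lt_iff (x := (0 : ℂ)) (r := b * (1 + η)) hFc).1
    (by rw [← hb]; nlinarith)
  rw [dist_zero_left] at hv
  obtain ⟨L, u, hLu, huL⟩ := RCLike.geometric_hahn_banach_closed_point (𝕜 := ℂ) hconv.closure
    isClosed_closure (x := !₂[(0 : ℂ), v]) hvF
  set c := L !₂[1, 0] with hc
  set ν := L !₂[0, 1] with hν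
  have hL : ∀ z : EuclideanSpace ℂ (Fin 2), L z = c * z 0 + ν * z 1 := by
    intro z
    have : z = z 0 • !₂[(1 : ℂ), 0] + z 1 • !₂[(0 : ℂ), 1] := by
      ext i
      fin_cases i <;> simp
    conv_lhs => rw [this, map_add, map_smul, map_smul]
    simp only [smul_eq_mul, hc, hν]
    ring
  simp only [hL, RCLike.re_to_complex, Complex.add_re] at hLu huL
  simp only [Matrix.cons_val_zero, Matrix.cons_val_one, Matrix.cons_val_fin_one, mul_zero,
    Complex.zero_re, zero_add] at huL
  have hFk : ∀ y ∈ F, (ν * y).re < (ν * v).re := by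
    intro y hy
    have := hLu _ hy
    simp only [Matrix.cons_val_zero, Matrix.cons_val_one, Matrix.cons_val_fin_one, mul_zero,
      Complex.zero_re, zero_add] at this
    linarith
  have hν0 : ν ≠ 0 := by
    intro h
    have := hFk 0 (hball 0 (by simpa using hr))
    simp [h] at this
  have hνn : 0 < ‖ν‖ := norm_pos_iff.2 hν0
  set ω : ℂ := (‖ν‖ : ℂ) / ν with hω
  have hωn : ‖ω‖ = 1 := by
    rw [hω, norm_div, Complex.norm_real, norm_norm, div_self hνn.ne']
  have hνω : ν * ω = (‖ν‖ : ℂ) := by rw [hω, mul_div_cancel₀ _ hν0]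
  set ρ := (1 - η) * b with hρ
  have hρ0 : 0 < ρ := mul_pos (by linarith) hb0
  -- `ρ ω` is the point of the circle of radius `ρ` where `Re (ν ·)` is largest, and it lies in the
  -- face.
  have hkl : ρ * ‖ν‖ < (ν * v).re := by
    have := hFk (ρ * ω) (hbF _ (by
      rw [norm_mul, hωn, mul_one, Complex.norm_real, Real.norm_eq_abs, abs_of_pos hρ0, hρ]
      nlinarith))
    rwa [mul_left_comm, hνω, Complex.re_ofReal_mul, Complex.ofReal_re] at this
  have hku : (ν * v).re ≤ ‖ν‖ * (b * (1 + η)) :=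
    (Complex.re_le_norm _).trans (by rw [norm_mul]; exact mul_le_mul_of_nonneg_left hv.le hνn.le)
  set B := b * ‖ν‖ with hB
  have hB0 : 0 < B := mul_pos hb0 hνn
  -- The first bound keeps `z 0 / η` inside the ball of radius `r`; the second makes the tilt `a *
  -- c.re` of the half-space negligible.
  set a := min (η * r / (2 * M)) (η * B / (|c.re| + 1)) with ha
  have hM0 : 0 < M := by linarith
  have ha0 : 0 < a := lt_min (by positivity) (by positivity)
  have ha1 : a * M ≤ η * r / 2 := by
    have : a ≤ η * r / (2 * M) := min_le_left _ _
    rw [le_div_iff₀ (by positivity)] at this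
    linarith
  have ha2 : a * |c.re| ≤ η * B := by
    have : a ≤ η * B / (|c.re| + 1) := min_le_right _ _
    rw [le_div_iff₀ (by positivity)] at this
    linarith
  refine ⟨a, ρ, (ν * v).re, ω, -c, ν, ha0, hρ0, hωn, ?_, ?_, ?_⟩
  · intro z hz1 hz2 hz3
    have hzre : 0 < (z 0).re := lt_of_lt_of_le (by positivity) hz1
    -- `z` is the combination, with weights `η` and `1 - η`, of `(z 0 / η, 0)` in `D` and `(0, z 1 /
    -- (1 - η))` in the face.
    have h1 : !₂[((η⁻¹ : ℝ) : ℂ) * z 0, 0] ∈ D := by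
      refine hflat _ ((norm_le_norm_add_norm_apply _).trans_lt ?_) ?_
      · simp only [Matrix.cons_val_zero, Matrix.cons_val_one, Matrix.cons_val_fin_one, norm_mul,
          Complex.norm_real, Real.norm_eq_abs, norm_zero, add_zero, abs_of_pos (inv_pos.2 hη0)]
        rw [inv_mul_lt_iff₀ hη0]
        have : 0 < η * r := by positivity
        linarith
      · simp only [Matrix.cons_val_zero]
        rw [Complex.re_ofReal_mul]
        positivity
    have hη1 : 0 < 1 - η := by linarith
    have h2 : (((1 - η)⁻¹ : ℝ) : ℂ) * z 1 ∈ F := by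
      refine hbF _ ?_
      rw [norm_mul, Complex.norm_real, Real.norm_eq_abs, abs_of_pos (inv_pos.2 hη1),
        inv_mul_lt_iff₀ hη1]
      exact hz3
    have h3 := hconv.combo_interior_closure_mem_interior (by rwa [hopen.interior_eq]) h2 hη0
      hη1.le (by ring)
    rw [hopen.interior_eq] at h3
    convert h3 using 1
    have e1 : (η : ℂ) ≠ 0 := by exact_mod_cast hη0.ne'
    have e2 : (1 - (η : ℂ)) ≠ 0 := by exact_mod_cast hη1.ne'
    ext i
    fin_cases i
    · simp [e1]
    · simp
      field_simp
  · intro z hz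
    have := hLu z (subset_closure hz)
    rw [neg_mul, Complex.neg_re]
    linarith
  · rw [hνω, Complex.ofReal_re, Complex.neg_re]
    have hτ := sq_mul_one_sub_double_le_two hT0 hT1
    rw [← hq] at hτ
    set τ := 2 * T / (1 + T ^ 2)
    have hτ1 : τ ≤ 1 := by
      have : 0 < q ^ 2 := by positivity
      rw [div_le_one (by positivity)]
      nlinarith [sq_nonneg (1 - T)]
    have hτ0 : 0 ≤ τ := by positivity
    have habs := abs_le.1 (show |a * c.re| ≤ η * B by rwa [abs_mul, abs_of_pos ha0])
    have e1 : ρ * ‖ν‖ = (1 - η) * B := by rw [hρ, hB]; ring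
    have e2 : ‖ν‖ * (b * (1 + η)) = (1 + η) * B := by rw [hB]; ring
    rw [e1] at hkl
    rw [e2] at hku
    have s1 : (ν * v).re + a * -c.re - ρ * τ * ‖ν‖ ≤ 3 * η * B + (1 - τ) * B := by
      have : ρ * τ * ‖ν‖ = τ * ((1 - η) * B) := by rw [← e1]; ring
      rw [this]
      have : τ * (η * B) ≤ 1 * (η * B) := mul_le_mul_of_nonneg_right hτ1 (by positivity)
      linarith
    have s2 : q ^ 2 * (3 * η * B + (1 - τ) * B) ≤ 3 * B := by
      have : q ^ 2 * (3 * η * B + (1 - τ) * B) = 3 * (q ^ 2 * η) * B + q ^ 2 * (1 - τ) * B := by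
        ring
      rw [this, hqη]
      have := mul_le_mul_of_nonneg_right hτ hB0.le
      linarith
    have s3 : η * B ≤ 1 / 4 * B := mul_le_mul_of_nonneg_right hη4 hB0.le
    have s4 := mul_le_mul_of_nonneg_left s1 (show 0 ≤ q ^ 2 by positivity)
    linarith

/-! ### Almost-products at points of steep tangency -/

/-- A function of finite order at `0` does not vanish to infinite order. -/
theorem not_vanishesToInfiniteOrder_of_pow_le {ψ : ℝ → ℝ} {δ : ℝ} (hδ : 0 < δ) (N : ℕ)
    (h : ∀ x, 0 < x → x < δ → x ^ N ≤ ψ x) : ¬ VanishesToInfiniteOrder ψ := by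
  intro hψ
  have hle : limsup (fun x : ℝ => ENNReal.log (ENNReal.ofReal (ψ |x|)) /
      ((Real.log |x| : ℝ) : EReal)) (𝓝[≠] 0) ≤ ((N : ℝ) : EReal) := by
    refine limsup_le_of_le (by isBoundedDefault) ?_
    have hev : ∀ᶠ x : ℝ in 𝓝[≠] 0, |x| < min δ 1 := by
      have : Tendsto (fun x : ℝ => |x|) (𝓝[≠] 0) (𝓝 0) := by
        simpa using (continuous_abs.tendsto (0 : ℝ)).mono_left nhdsWithin_le_nhds
      exact this.eventually (Iio_mem_nhds (lt_min hδ one_pos))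
    filter_upwards [hev, self_mem_nhdsWithin] with x hx hx0
    have hx0 : 0 < |x| := abs_pos.2 hx0
    have hp := h |x| hx0 (hx.trans_le (min_le_left _ _))
    have hψ0 : 0 < ψ |x| := lt_of_lt_of_le (by positivity) hp
    have hlog : Real.log |x| < 0 := Real.log_neg hx0 (hx.trans_le (min_le_right _ _))
    rw [ENNReal.log_ofReal_of_pos hψ0, ← EReal.coe_div, EReal.coe_le_coe_iff,
      div_le_iff_of_neg hlog, ← Real.log_pow]
    exact Real.log_le_log (by positivity) hp
  rw [hψ, top_le_iff] at hle
  exact EReal.coe_ne_top _ hle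

/-- The logarithmic derivative `x ψ'(x) / ψ(x)` of a function vanishing to infinite order is
unbounded near `0`. -/
theorem VanishesToInfiniteOrder.exists_mul_le_mul_deriv {ψ : ℝ → ℝ}
    (hψ : VanishesToInfiniteOrder ψ) {δ : ℝ} (hδ : 0 < δ)
    (hdiff : ∀ x ∈ Ioo 0 δ, DifferentiableAt ℝ ψ x) (hpos : ∀ x ∈ Ioo 0 δ, 0 < ψ x) (N : ℕ) :
    ∃ x ∈ Ioo 0 δ, N * ψ x ≤ x * deriv ψ x := by
  by_contra! hcon
  -- If `x ψ' < N ψ` throughout, the derivative of `ψ / x ^ N` is nonpositive, which forces `ψ ≥ c x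
  -- ^ N` near `0`.
  have hanti : AntitoneOn (fun x => ψ x / x ^ N) (Ioo 0 δ) := by
    have hd : ∀ x ∈ Ioo 0 δ, HasDerivAt (fun x => ψ x / x ^ N)
        ((deriv ψ x * x ^ N - ψ x * (N * x ^ (N - 1))) / (x ^ N) ^ 2) x := fun x hx =>
      (hdiff x hx).hasDerivAt.div (hasDerivAt_pow N x) (pow_ne_zero _ hx.1.ne')
    refine antitoneOn_of_deriv_nonpos (convex_Ioo 0 δ)
      (fun x hx => (hd x hx).continuousAt.continuousWithinAt)
      (fun x hx => (hd x (interior_subset hx)).differentiableAt.differentiableWithinAt) ?_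
    intro x hx
    have hx := interior_subset hx
    rw [(hd x hx).deriv]
    refine div_nonpos_of_nonpos_of_nonneg ?_ (by positivity)
    have hx0 : 0 < x := hx.1
    have h1 := hcon x hx
    rcases Nat.eq_zero_or_pos N with rfl | hN
    · simp only [CharP.cast_eq_zero, zero_mul, pow_zero, mul_one, mul_zero, sub_zero] at h1 ⊢
      nlinarith
    · have e : x ^ N = x ^ (N - 1) * x := by rw [← pow_succ, Nat.sub_add_cancel hN]
      rw [e]
      have h2 : 0 < x ^ (N - 1) := by positivity
      nlinarith
  have hy : δ / 2 ∈ Ioo 0 δ := ⟨by linarith, by linarith⟩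
  set y := δ / 2 with hydef
  set c := ψ y / y ^ N with hc
  have hc0 : 0 < c := div_pos (hpos y hy) (pow_pos hy.1 _)
  -- The extra power absorbs the constant: `x ^ (N + 1) ≤ c * x ^ N` for `x < c`.
  refine not_vanishesToInfiniteOrder_of_pow_le (lt_min hy.1 hc0) (N + 1) ?_ hψ
  intro x hx0 hx
  have hxy : x ≤ y := (hx.trans_le (min_le_left _ _)).le
  have h1 : c ≤ ψ x / x ^ N := hanti ⟨hx0, hxy.trans_lt hy.2⟩ hy hxy
  rw [le_div_iff₀ (by positivity)] at h1
  rw [pow_succ']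
  exact (mul_le_mul_of_nonneg_right (hx.trans_le (min_le_right _ _)).le (by positivity)).trans h1

theorem ConvexOn.add_deriv_mul_sub_le {S : Set ℝ} {f : ℝ → ℝ} (hf : ConvexOn ℝ S f) {x y : ℝ}
    (hx : x ∈ S) (hy : y ∈ S) (hd : DifferentiableAt ℝ f x) :
    f x + deriv f x * (y - x) ≤ f y := by
  rcases lt_trichotomy x y with h | rfl | h
  · have := hf.deriv_le_slope hx hy h hd
    rw [slope_def_field, le_div_iff₀ (sub_pos.2 h)] at this
    linarith
  · simp
  · have := hf.slope_le_deriv hy hx h hd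
    rw [slope_def_field, div_le_iff₀ (sub_pos.2 h)] at this
    linarith

/-- The chord from `0` to `x` gives `ψ y ≤ (y / x) ψ x`. This controls `ψ ‖z 1‖` on a whole disc by
its value at the radius. -/
theorem ConvexOn.le_of_nonneg_of_le {ε : ℝ} {ψ : ℝ → ℝ} (hconv : ConvexOn ℝ (Ioo (-ε) ε) ψ)
    (hnonneg : ∀ x ∈ Ioo (-ε) ε, 0 ≤ ψ x) (hzero : ψ 0 = 0) {x y : ℝ} (hy : 0 ≤ y) (hyx : y ≤ x)
    (hx : x < ε) : ψ y ≤ ψ x := by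
  rcases hy.eq_or_lt with rfl | hy
  · rw [hzero]
    exact hnonneg x ⟨by linarith, hx⟩
  have hx0 : 0 < x := hy.trans_le hyx
  have h := hconv.2 (show (0 : ℝ) ∈ Ioo (-ε) ε from ⟨by linarith, by linarith⟩)
    (show x ∈ Ioo (-ε) ε from ⟨by linarith, hx⟩)
    (sub_nonneg.2 ((div_le_one hx0).2 hyx)) (show 0 ≤ y / x by positivity) (by ring)
  simp only [smul_eq_mul, mul_zero, zero_add, hzero] at h
  rw [div_mul_cancel₀ _ hx0.ne'] at h
  exact h.trans (mul_le_of_le_one_left (hnonneg x ⟨by linarith, hx⟩) ((div_le_one hx0).2 hyx))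

/-- At a boundary point `(ψ(x), x)` with `x ψ'(x)` much larger than `ψ(x)`, the tangent half-space
and the product below it yield almost-products. -/
theorem exists_almost_product_of_infinite_order {D : Set (EuclideanSpace ℂ (Fin 2))}
    (hopen : IsOpen D) (hconv : Convex ℝ D) {ψ : ℝ → ℝ} {ε r : ℝ} (hε : 0 < ε)
    (hdiff : ∀ x ∈ Ioo (-ε) ε, DifferentiableAt ℝ ψ x) (hψ_conv : ConvexOn ℝ (Ioo (-ε) ε) ψ)
    (hψ_nonneg : ∀ x ∈ Ioo (-ε) ε, 0 ≤ ψ x) (hψ_zero : ψ 0 = 0)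
    (hψ_order : VanishesToInfiniteOrder ψ) (hpos : ∀ x ∈ Ioo 0 ε, 0 < ψ x) (hr : 0 < r)
    (hD : ∀ z : EuclideanSpace ℂ (Fin 2), ‖z‖ < r → (z ∈ D ↔ -(z 0).re + ψ ‖z 1‖ < 0))
    {T M : ℝ} (hT0 : 0 < T) (hT1 : T < 1) (hM : 1 < M) :
    ∃ (a ρ k : ℝ) (ω c ν : ℂ), 0 < a ∧ 0 < ρ ∧ ‖ω‖ = 1 ∧
      (∀ z : EuclideanSpace ℂ (Fin 2), a / M ≤ (z 0).re → ‖z 0‖ ≤ a * M → ‖z 1‖ < ρ → z ∈ D) ∧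
      (∀ z ∈ D, 0 < k + (c * z 0).re - (ν * z 1).re) ∧
      ((1 + T) / (1 - T)) ^ 2 * (k + a * c.re - ρ * (2 * T / (1 + T ^ 2)) * (ν * ω).re) ≤
        10 * (k + a * c.re) := by
  have hM0 : 0 < M := by linarith
  set q := (1 + T) / (1 - T) with hq
  have hq0 : 0 < q := div_pos (by linarith) (by linarith)
  obtain ⟨δ, hδ0, hδ⟩ : ∃ δ > 0, ∀ x ∈ Ioo 0 δ, x < r / 2 ∧ x < ε ∧ 2 * M ^ 2 * ψ x < r / 2 := by
    have hcont : Tendsto (fun x => 2 * M ^ 2 * ψ x) (𝓝[>] 0) (𝓝 0) := by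
      have := ((hdiff 0 ⟨by linarith, hε⟩).continuousAt.tendsto.const_mul (2 * M ^ 2)).mono_left
        (nhdsWithin_le_nhds (s := Ioi 0))
      simpa [hψ_zero] using this
    have h1 : ∀ᶠ x : ℝ in 𝓝[>] 0, x < r / 2 ∧ x < ε ∧ 2 * M ^ 2 * ψ x < r / 2 := by
      filter_upwards [mem_nhdsWithin_of_mem_nhds (Iio_mem_nhds (half_pos hr)),
        mem_nhdsWithin_of_mem_nhds (Iio_mem_nhds hε),
        hcont.eventually (Iio_mem_nhds (half_pos hr))] with x h1 h2 h3 using ⟨h1, h2, h3⟩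
    exact mem_nhdsGT_iff_exists_Ioo_subset.1 h1
  -- This makes `q ^ 2 * a = 2 M q ^ 2 ψ x` at most `x * m` in the final ratio.
  obtain ⟨N, hN⟩ := exists_nat_ge (2 * M * q ^ 2)
  obtain ⟨x, hx, hxN⟩ := hψ_order.exists_mul_le_mul_deriv hδ0
    (fun x hx => hdiff x ⟨by linarith [hx.1], (hδ x hx).2.1⟩)
    (fun x hx => hpos x ⟨hx.1, (hδ x hx).2.1⟩) N
  obtain ⟨hxr, hxε, hψr⟩ := hδ x hx
  have hx0 : 0 < x := hx.1
  have hxI : x ∈ Ioo (-ε) ε := ⟨by linarith, hxε⟩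
  have hψx : 0 < ψ x := hpos x ⟨hx0, hxε⟩
  set m := deriv ψ x with hm
  have hslope : 2 * M * q ^ 2 * ψ x ≤ x * m := (mul_le_mul_of_nonneg_right hN hψx.le).trans hxN
  have hm0 : 0 < m := by
    have : 0 < x * m := lt_of_lt_of_le (by positivity) hslope
    exact pos_of_mul_pos_right this hx0.le
  have hψr' : ψ x < r / 2 := by
    have : (1 : ℝ) ≤ 2 * M ^ 2 := by nlinarith
    exact (le_mul_of_one_le_left hψx.le this).trans_lt hψr
  -- With this `a`, the lowest height `a / M` is `2 ψ x`, safely above the graph over `‖z 1‖ < x`;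
  -- `k`, `c`, `ν` describe the tangent half-space at `(ψ x, x)`.
  refine ⟨2 * M * ψ x, x, m * x - ψ x, 1, 1, (m : ℂ), by positivity, hx0, by simp, ?_, ?_, ?_⟩
  · intro z hz1 hz2 hz3
    have e : 2 * M * ψ x / M = 2 * ψ x := by field_simp
    rw [e] at hz1
    refine (hD z ((norm_le_norm_add_norm_apply z).trans_lt ?_)).2 ?_
    · have : 2 * M * ψ x * M = 2 * M ^ 2 * ψ x := by ring
      linarith
    · have := hψ_conv.le_of_nonneg_of_le hψ_nonneg hψ_zero (norm_nonneg (z 1)) hz3.le hxε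
      linarith
  · intro z hz
    set P : EuclideanSpace ℂ (Fin 2) := !₂[(ψ x : ℂ), (x : ℂ)] with hP
    have hPr : ‖P‖ < r := by
      refine (norm_le_norm_add_norm_apply P).trans_lt ?_
      simp only [hP, Matrix.cons_val_zero, Matrix.cons_val_one, Matrix.cons_val_fin_one,
        Complex.norm_real, Real.norm_eq_abs, abs_of_pos hx0, abs_of_pos hψx]
      linarith
    have hPD : P ∈ closure D := by
      refine mem_closure_of_forall_pos (sub_pos.2 hψr') fun s hs0 hs => (hD _ ?_).2 ?_
      · refine (norm_le_norm_add_norm_apply _).trans_lt ?_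
        simp only [Matrix.cons_val_zero, Matrix.cons_val_one, Matrix.cons_val_fin_one,
          Complex.norm_real, Real.norm_eq_abs, abs_of_pos hx0, abs_of_pos (add_pos hψx hs0)]
        linarith
      · simp only [Matrix.cons_val_zero, Matrix.cons_val_one, Matrix.cons_val_fin_one,
          Complex.norm_real, Real.norm_eq_abs, abs_of_pos hx0, Complex.ofReal_re]
        linarith
    have hlt := hconv.lt_of_eventually_lt_near hopen hPD
      (l := fun z : EuclideanSpace ℂ (Fin 2) => (z 0).re - m * (z 1).re)
      (fun z s => by
        simp only [PiLp.add_apply, PiLp.smul_apply, Complex.add_re, Complex.smul_re, smul_eq_mul]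
        ring) ?_ hz
    · simp only [hP, Matrix.cons_val_zero, Matrix.cons_val_one, Matrix.cons_val_fin_one,
        Complex.ofReal_re] at hlt
      rw [one_mul, Complex.re_ofReal_mul]
      linarith
    · have hnear : ∀ᶠ z in 𝓝 P, ‖z‖ < r ∧ ‖z 1‖ < ε := by
        have c1 : Continuous fun z : EuclideanSpace ℂ (Fin 2) => ‖z‖ := continuous_norm
        have c2 : Continuous fun z : EuclideanSpace ℂ (Fin 2) => ‖z 1‖ := by fun_prop
        refine ((c1.tendsto P).eventually (Iio_mem_nhds hPr)).and
          ((c2.tendsto P).eventually (Iio_mem_nhds ?_))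
        simpa [hP, abs_of_pos hx0] using hxε
      filter_upwards [hnear] with z hz hzD
      have h1 := (hD z hz.1).1 hzD
      -- Near `P`, the tangent line of `ψ` at `x` and `Re z 1 ≤ ‖z 1‖` with `m > 0` give the
      -- half-space; convexity of `D` makes it global.
      have h2 := hψ_conv.add_deriv_mul_sub_le hxI
        (show ‖z 1‖ ∈ Ioo (-ε) ε from ⟨by linarith [norm_nonneg (z 1)], hz.2⟩) (hdiff x hxI)
      have h3 := mul_le_mul_of_nonneg_left (Complex.re_le_norm (z 1)) hm0.le
      simp only [hP, Matrix.cons_val_zero, Matrix.cons_val_one, Matrix.cons_val_fin_one,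
        Complex.ofReal_re]
      rw [← hm] at h2
      linarith
  · have hτ := sq_mul_one_sub_double_le_two hT0 hT1
    rw [← hq] at hτ
    set τ := 2 * T / (1 + T ^ 2)
    simp only [Complex.one_re, mul_one, Complex.ofReal_re]
    have h1 : q ^ 2 * (m * x - ψ x + 2 * M * ψ x - x * τ * m) =
        (q ^ 2 * (1 - τ)) * (x * m) + 2 * M * q ^ 2 * ψ x - q ^ 2 * ψ x := by ring
    have h2 := mul_le_mul_of_nonneg_right hτ (mul_pos hx0 hm0).le
    have h3 : 0 < q ^ 2 * ψ x := by positivity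
    have h4 : ψ x ≤ 2 * M * ψ x := by nlinarith
    have h5 : 0 < x * m := mul_pos hx0 hm0
    rw [h1]
    linarith

/-! ### The theorem: flat or strictly positive profile -/

theorem theorem2 (D : Set (EuclideanSpace ℂ (Fin 2))) (hD_open : IsOpen D)
    (hD_conv : Convex ℝ D) (hD_bdd : Bornology.IsBounded D) (hD_smooth : HasC11Boundary D)
    (ψ : ℝ → ℝ) (ε : ℝ) (hε : 0 < ε)
    (hψ_smooth : IsC11On ψ (Ioo (-ε) ε)) (hψ_conv : ConvexOn ℝ (Ioo (-ε) ε) ψ)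
    (hψ_nonneg : ∀ x ∈ Ioo (-ε) ε, 0 ≤ ψ x) (hψ_zero : ψ 0 = 0)
    (hψ_order : VanishesToInfiniteOrder ψ)
    (hD_def : ∀ᶠ z in 𝓝 (0 : EuclideanSpace ℂ (Fin 2)), z ∈ D ↔ -(z 0).re + ψ ‖z 1‖ < 0) :
    ¬ IsGromovHyperbolicOn D (kobayashiDist D) := by
  obtain ⟨r, hr, hD⟩ := Metric.eventually_nhds_iff.1 hD_def
  replace hD : ∀ z : EuclideanSpace ℂ (Fin 2), ‖z‖ < r → (z ∈ D ↔ -(z 0).re + ψ ‖z 1‖ < 0) :=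
    fun z hz => hD (by simpa using hz)
  have hdiff : ∀ x ∈ Ioo (-ε) ε, DifferentiableAt ℝ ψ x := fun x hx =>
    (hψ_smooth.1.differentiableOn one_ne_zero).differentiableAt (isOpen_Ioo.mem_nhds hx)
  have h0 : (0 : EuclideanSpace ℂ (Fin 2)) ∈ closure D := by
    have := mem_closure_of_forall_pos (D := D) (b := 0) (v := 0) hr fun s hs0 hs => (hD _ ?_).2 ?_
    · convert this using 1
      ext i
      fin_cases i <;> simp
    · refine (norm_le_norm_add_norm_apply _).trans_lt ?_
      simpa [abs_of_pos hs0] using hs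
    · simpa [hψ_zero] using hs0
  have hre : ∀ z ∈ D, 0 < (z 0).re := by
    intro z hz
    have := hD_conv.lt_of_eventually_lt_near hD_open h0
      (l := fun z : EuclideanSpace ℂ (Fin 2) => (z 0).re) (fun z s => by simp) ?_ hz
    · simpa using this
    · have c1 : Continuous fun z : EuclideanSpace ℂ (Fin 2) => ‖z 1‖ := by fun_prop
      have h1 : ∀ᶠ z in 𝓝 (0 : EuclideanSpace ℂ (Fin 2)), ‖z 1‖ < ε :=
        c1.tendsto 0 (Iio_mem_nhds (by simpa using hε))
      filter_upwards [hD_def, h1] with z hz hzε hzD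
      have h2 := hz.1 hzD
      have h3 := hψ_nonneg ‖z 1‖ ⟨by linarith [norm_nonneg (z 1)], hzε⟩
      simp only [PiLp.zero_apply, Complex.zero_re]
      linarith
  refine not_isGromovHyperbolicOn_of_almost_products hre fun T M hT0 hT1 hM => ?_
  by_cases hpos : ∀ x ∈ Ioo 0 ε, 0 < ψ x
  · exact exists_almost_product_of_infinite_order hD_open hD_conv hε hdiff hψ_conv hψ_nonneg
      hψ_zero hψ_order hpos hr hD hT0 hT1 hM
  · push Not at hpos
    obtain ⟨y, hy, hψy⟩ := hpos
    -- A zero of `ψ` at `y` forces `ψ = 0` on `[0, y]` by monotonicity, so `D` is a half-space near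
    -- `0`.
    refine exists_almost_product_of_flat hD_open hD_conv hD_bdd (lt_min hr hy.1) ?_ hT0 hT1 hM
    intro z hz hz0
    refine (hD z (hz.trans_le (min_le_left _ _))).2 ?_
    have h1 : ‖z 1‖ ≤ y :=
      ((PiLp.norm_apply_le z 1).trans_lt (hz.trans_le (min_le_right _ _))).le
    have := hψ_conv.le_of_nonneg_of_le hψ_nonneg hψ_zero (norm_nonneg (z 1)) h1 hy.2
    linarith
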